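/- **Setting.** A SATA instance consists of a finite set $R$ of robots and a finite nonempty set $T$ of targets (each with a unique label in $\mathbb N$); for each robot $i\in R$ a finite set $P^i$ of motion primitives; for each primitive $m\in P^i$ the set $\mathcal{RS}(\mathbf p^i_m)\subseteq T$ of targets it can see; weights $c_{i,m}^j\ge 0$ with $c_{i,m}^j=0$ if $m$ does not see $j$; and a communication graph on $R$ in which any two distinct robots having primitives that see a common target are adjacent. The LP relaxation of the Bottleneck version of SATA is $$\max\; w\quad\text{s.t.}\quad \sum_{m\in P^i}x^i_m\le 1\ (i\in R),\qquad \sum_{i\in R}\sum_{m\in P^i}c_{i,m}^j x_m^i\ge w\ (j\in T),\qquad x^i_m\ge 0 .$$ A local algorithm is a deterministic synchronous message-passing algorithm, with no bound on message size or local computation: every robot runs the same algorithm, starts knowing only its own label, primitives, the targets they see and their weights, and in each round exchanges messages with its neighbours in the communication graph; in the end robot $i$ outputs $(x^i_m)_{m\in P^i}$. **Theorem.** There is an absolute constant $C$ such that for all integers $\Delta_R\ge 2$, $\Delta_T\ge 2$, $h\ge 1$ and all real $\varepsilon>0$ there are a local algorithm and a number of rounds $$t\le C\,h\,\max\{0,\log(1/\varepsilon)\}$$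 such that on every SATA instance in which each robot has at most $\Delta_R$ motion primitives and each target is seen by at most $\Delta_T$ motion primitives, the output $x$ of the algorithm after $t$ rounds is a feasible solution of the LP relaxation whose value is at least $\mathrm{OPT}/\rho$, where $\mathrm{OPT}$ is the optimal value of the LP and $$\rho=\Delta_R(1+\varepsilon)\left(1+\frac1h\right)\left(1-\frac1{\Delta_T}\right).$$ -/

import Mathlib

/-- What one robot knows about itself at the current time step. -/
structure RobotData where
  /-- number of motion primitives; the primitives are labelled by `Fin numPrimitives` -/
  numPrimitives : ℕ
  /-- `RS m` is the set of (labels of) targets that can be observed by the primitive `m` -/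
  RS : Fin numPrimitives → Finset ℕ
  /-- `c m j` is the weight (tracking quality) of the primitive `m` for the target `j` -/
  c : Fin numPrimitives → ℕ → ℝ
  /-- weights are nonnegative -/
  c_nonneg : ∀ m j, 0 ≤ c m j
  /-- weights live on the sensing edges only -/
  c_eq_zero : ∀ m j, j ∉ RS m → c m j = 0

/-- An instance of simultaneous action and target assignment (SATA) at one time step. Robots and
targets carry distinct labels, taken from the natural numbers. -/
structure SATAInstance where
  /-- labels of the robots -/
  R : Finset ℕ
  /-- labels of the targets -/
  T : Finset ℕ
  T_nonempty : T.Nonempty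
  /-- the primitives, observable targets and weights of each robot -/
  data : R → RobotData
  RS_subset : ∀ i m, (data i).RS m ⊆ T
  /-- the communication graph on the robots -/
  comm : SimpleGraph R
  /-- two robots with primitives that can observe a common target can communicate -/
  comm_range : ∀ i l : R, i ≠ l →
    (∃ m m' j, j ∈ (data i).RS m ∧ j ∈ (data l).RS m') → comm.Adj i l

namespace SATAInstance

/-- The maximum number of motion primitives per robot. -/
def maxPrimitivesPerRobot (S : SATAInstance) : ℕ :=
  Finset.univ.sup fun i : S.R => (S.data i).numPrimitives

/-- The number of motion primitives (of all robots together) that can see the target `j`. -/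
def numSeeing (S : SATAInstance) (j : ℕ) : ℕ :=
  (Finset.univ.filter fun p : (Σ i : S.R, Fin (S.data i).numPrimitives) =>
    j ∈ (S.data p.1).RS p.2).card

/-- The maximum number of motion primitives that can see a target. -/
def maxPrimitivesPerTarget (S : SATAInstance) : ℕ :=
  S.T.sup S.numSeeing

/-- A choice of one real variable `x i m` for each motion primitive `m` of each robot `i`. -/
abbrev Assignment (S : SATAInstance) : Type :=
  (i : S.R) → Fin (S.data i).numPrimitives → ℝ

/-- Feasibility of `(x, w)` for the LP relaxation of the bottleneck problem, whose objective is to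
maximize `w`. -/
structure LPFeasible (S : SATAInstance) (x : S.Assignment) (w : ℝ) : Prop where
  packing : ∀ i, ∑ m, x i m ≤ 1
  covering : ∀ j ∈ S.T, w ≤ ∑ i, ∑ m, (S.data i).c m j * x i m
  nonneg : ∀ i m, 0 ≤ x i m

/-- `x` is a `ρ`-approximate solution of the LP relaxation of the bottleneck problem: it is
feasible, with an objective value `w` such that no feasible value exceeds `ρ * w`. -/
def IsApproxSolution (S : SATAInstance) (ρ : ℝ) (x : S.Assignment) : Prop :=
  ∃ w, S.LPFeasible x w ∧ ∀ x' w', S.LPFeasible x' w' → w' ≤ ρ * w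

end SATAInstance

/-- A deterministic synchronous message-passing algorithm, run identically by every robot. A robot
starts from its own label and its own data only. In each round it broadcasts one message to its
neighbours in the communication graph, receives the set of its neighbours' messages (each with the
label of its sender), and updates its state. Finally `out s m` is the value that a robot in
state `s` gives to the variable of its primitive number `m`. -/
structure LocalAlgorithm where
  State : Type
  Msg : Type
  init : ℕ → RobotData → State
  send : State → Msg
  step : State → Set (ℕ × Msg) → State
  out : State → ℕ → ℝ

namespace LocalAlgorithm

/-- The state of each robot after a given number of synchronous communication rounds. -/
def run (A : LocalAlgorithm) (S : SATAInstance) : ℕ → S.R → A.State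
  | 0, i => A.init i (S.data i)
  | t + 1, i => A.step (A.run S t i)
      {p | ∃ l : S.R, S.comm.Adj i l ∧ p = ((l : ℕ), A.send (A.run S t l))}

/-- The assignment that the robots output after `t` rounds. -/
def result (A : LocalAlgorithm) (S : SATAInstance) (t : ℕ) : S.Assignment :=
  fun i m => A.out (A.run S t i) m

end LocalAlgorithm

/-!
For a target value `ω`, any feasible solution of value `ω` is sandwiched between bounds that can be
computed locally. Start from the upper bound `1` on every primitive; a target needs total weight
`ω`, so upper bounds on the other primitives that see it give a lower bound on each primitive
(`demand`); primitives of one robot share a budget of `1`, so lower bounds on the others give a new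
upper bound (`capacity`). Iterating yields `lower d ≤ x ≤ upper d` for all `d`
(`LPFeasible.lower_le_upper`). A value `ω` is called consistent at a robot if `lower d ≤ upper d`
holds at its primitives for all `d < h`; every feasible value is.

Let the threshold of a robot be the largest value that is consistent at all robots within `h` hops.
It is at least the optimum (`LPFeasible.le_threshold`). Running the recursion with each robot using
its own threshold in place of `ω` still gives `lower d ≤ upper d`
(`lower_threshold_le_upper_threshold`): the bounds at `p` depend monotonically on the thresholds
near `p`, and the largest of these thresholds is consistent at `p`.

The output is proportional to `∑ d < h, (upper d + lower d)`.
* *Packing.* For distinct primitives `p, q` of one robot, `upper (d + 1) p + lower d q ≤ 1` by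
  the definition of `capacity`, so the sums of `p` and `q` add up to at most `2 * (h + 1)`
  (`levelSum_add_le`). Hence dividing by `2 * (h + 1)` makes the pairwise sums at most `1`, and a
  robot with `n ≥ 2` primitives rescales by `2 / n`.
* *Covering.* At a target seen with positive weight by `n ≤ ΔT` primitives, let `G` and `L` be the
  weighted sums of `upper d` and `lower d`. By the definition of `demand`,
  `L ≥ n * (w - G) + G` for every feasible `w > 0`, while `G ≥ w` and `L ≥ 0`; together these give
  `(ΔT - 1) * (G + L) ≥ ΔT * w` (`LPFeasible.le_sum_upper_add_lower`).

The two estimates give the ratio `ΔR * (1 + 1 / h) * (1 - 1 / ΔT)`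
(`isApproxSolution_averaged`). Since messages are unbounded, the bounds can be sent as functions of
`ω`, so that `3 * h` rounds suffice (`LocallyComputable.averaged`), independently of `ε`. For small
`ε` this is within `O(h * log (1 / ε))`. When `ε` is close to `1`, the slack `1 + ε` in the ratio
either allows averaging over `2` levels only, or makes the uniform assignment good enough, which
needs no communication.
-/

/-! ### Maxima of finite families of reals with default value zero -/

section Fold

variable {ι : Type*}

theorem Finset.fold_max_zero_mono {s : Finset ι} {f g : ι → ℝ} (h : ∀ x ∈ s, f x ≤ g x) :
    s.fold max 0 f ≤ s.fold max 0 g :=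
  (Finset.fold_max_le _).2 ⟨(Finset.le_fold_max _).2 (Or.inl le_rfl),
    fun x hx => (Finset.le_fold_max _).2 (Or.inr ⟨x, hx, h x hx⟩)⟩

theorem Continuous.finset_fold_max {s : Finset ι} {f : ℝ → ι → ℝ}
    (h : ∀ x ∈ s, Continuous fun ω => f ω x) :
    Continuous fun ω => s.fold max 0 (f ω) := by
  classical
  induction s using Finset.induction_on with
  | empty => simpa using continuous_const
  | insert a s ha ih =>
    simp only [Finset.fold_insert ha]
    exact (h a (Finset.mem_insert_self a s)).max
      (ih fun x hx => h x (Finset.mem_insert_of_mem hx))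

end Fold

/-! ### Upper and lower bounds on the primitives -/

namespace SATAInstance

/-- The motion primitives of all robots together. -/
abbrev Primitive (S : SATAInstance) : Type :=
  Σ i : S.R, Fin (S.data i).numPrimitives

/-- The weight of the primitive `p` for the target `j`. -/
def weight (S : SATAInstance) (p : S.Primitive) (j : ℕ) : ℝ :=
  (S.data p.1).c p.2 j

/-- The least value of the variable of `p` with which the targets that `p` sees can reach the value
`s p.1` when all other variables are at most `u`. The maximum is taken with `0`; a target for which
`p` has weight `0` contributes `0`, by the convention for division by zero. -/
noncomputable def demand (S : SATAInstance) (s : S.R → ℝ) (u : S.Primitive → ℝ)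
    (p : S.Primitive) : ℝ :=
  ((S.data p.1).RS p.2).fold max 0 fun j =>
    (s p.1 - ∑ q ∈ Finset.univ.erase p, S.weight q j * u q) / S.weight p j

/-- The largest value that the variable of `p` can have when the other variables of the same robot
are at least `v`, using only constraints `x p + x q ≤ 1` on pairs of primitives of that robot. -/
noncomputable def capacity (S : SATAInstance) (v : S.Primitive → ℝ) (p : S.Primitive) : ℝ :=
  1 - (Finset.univ.erase p.2).fold max 0 fun m => v ⟨p.1, m⟩

/-- The upper bounds after `d` iterations, when the robot `i` asks for the value `s i` at the targets
that it sees. -/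
noncomputable def upper (S : SATAInstance) (s : S.R → ℝ) : ℕ → S.Primitive → ℝ
  | 0 => fun _ => 1
  | d + 1 => S.capacity (S.demand s (S.upper s d))

/-- The lower bounds that result from the upper bounds `upper s d`. -/
noncomputable def lower (S : SATAInstance) (s : S.R → ℝ) (d : ℕ) : S.Primitive → ℝ :=
  S.demand s (S.upper s d)

/-- The values `ω` for which the first `h` lower and upper bounds at the primitives of the robot `i`
do not contradict each other, all robots asking for the value `ω`. -/
def consistent (S : SATAInstance) (h : ℕ) (i : S.R) : Set ℝ :=
  {ω | ∀ d < h, ∀ m, S.lower (fun _ => ω) d ⟨i, m⟩ ≤ S.upper (fun _ => ω) d ⟨i, m⟩}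

/-- The robot `l` is within `k` hops of `i` in the communication graph. -/
def Near (S : SATAInstance) (k : ℕ) (i l : S.R) : Prop :=
  ∃ w : S.comm.Walk i l, w.length ≤ k

/-- The largest value that is consistent at all robots within `h` hops of `i`. If these values are
unbounded (for `h ≥ 1`, this means that no robot near `i` has a positive weight), the supremum is
`0` by convention, which is a consistent value. -/
noncomputable def threshold (S : SATAInstance) (h : ℕ) (i : S.R) : ℝ :=
  sSup {ω | ∀ l, S.Near h i l → ω ∈ S.consistent h l}

/-- The sum of the first `h` upper and lower bounds at `p`, computed with the thresholds. -/
noncomputable def levelSum (S : SATAInstance) (h : ℕ) (p : S.Primitive) : ℝ :=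
  ∑ d ∈ Finset.range h,
    (S.upper (S.threshold h) d p + S.lower (S.threshold h) d p)

/-- The approximate solution: `levelSum`, divided by `2 * (h + 1)` to satisfy the packing constraints
for pairs of primitives, then scaled by `2 / n` if the robot has `n ≥ 2` primitives, to satisfy the
one for all of them. -/
noncomputable def averaged (S : SATAInstance) (h : ℕ) : S.Assignment := fun i m =>
  min 1 (2 / ((S.data i).numPrimitives : ℝ)) / (2 * ((h : ℝ) + 1)) * S.levelSum h ⟨i, m⟩

variable {S : SATAInstance}

theorem weight_nonneg (p : S.Primitive) (j : ℕ) : 0 ≤ S.weight p j :=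
  (S.data p.1).c_nonneg p.2 j

theorem mem_RS_of_weight_pos {p : S.Primitive} {j : ℕ} (h : 0 < S.weight p j) :
    j ∈ (S.data p.1).RS p.2 := by
  by_contra hj
  exact h.ne' ((S.data p.1).c_eq_zero p.2 j hj)

theorem eq_or_adj_of_mem_RS {p q : S.Primitive} {j : ℕ} (hp : j ∈ (S.data p.1).RS p.2)
    (hq : j ∈ (S.data q.1).RS q.2) : p.1 = q.1 ∨ S.comm.Adj p.1 q.1 := by
  by_cases h : p.1 = q.1
  · exact Or.inl h
  · exact Or.inr (S.comm_range _ _ h ⟨p.2, q.2, j, hp, hq⟩)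

theorem demand_nonneg (s : S.R → ℝ) (u : S.Primitive → ℝ) (p : S.Primitive) :
    0 ≤ S.demand s u p :=
  (Finset.le_fold_max _).2 (Or.inl le_rfl)

theorem sub_sum_le_weight_mul_demand (s : S.R → ℝ) (u : S.Primitive → ℝ) {p : S.Primitive}
    {j : ℕ} (h : 0 < S.weight p j) :
    s p.1 - ∑ q ∈ Finset.univ.erase p, S.weight q j * u q ≤ S.weight p j * S.demand s u p := by
  rw [mul_comm, ← div_le_iff₀ h]
  exact (Finset.le_fold_max _).2 (Or.inr ⟨j, mem_RS_of_weight_pos h, le_rfl⟩)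

theorem capacity_le_one (v : S.Primitive → ℝ) (p : S.Primitive) : S.capacity v p ≤ 1 :=
  sub_le_self _ ((Finset.le_fold_max _).2 (Or.inl le_rfl))

theorem capacity_add_le_one (v : S.Primitive → ℝ) {i : S.R}
    {m m' : Fin (S.data i).numPrimitives} (h : m' ≠ m) :
    S.capacity v ⟨i, m⟩ + v ⟨i, m'⟩ ≤ 1 := by
  have : v ⟨i, m'⟩ ≤ (Finset.univ.erase m).fold max 0 fun m => v ⟨i, m⟩ :=
    (Finset.le_fold_max _).2 (Or.inr ⟨m', by simp [h], le_rfl⟩)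
  unfold capacity
  linarith

theorem upper_le_one (s : S.R → ℝ) (d : ℕ) (p : S.Primitive) : S.upper s d p ≤ 1 := by
  cases d with
  | zero => exact le_rfl
  | succ d => exact capacity_le_one _ _

theorem lower_nonneg (s : S.R → ℝ) (d : ℕ) (p : S.Primitive) : 0 ≤ S.lower s d p :=
  demand_nonneg _ _ _

/-! ### Feasible solutions lie between the bounds -/

theorem LPFeasible.le_sum_weight {x : S.Assignment} {w : ℝ} (hx : S.LPFeasible x w) {j : ℕ}
    (hj : j ∈ S.T) : w ≤ ∑ p : S.Primitive, S.weight p j * x p.1 p.2 := by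
  rw [Fintype.sum_sigma]
  exact hx.covering j hj

theorem LPFeasible.le_one {x : S.Assignment} {w : ℝ} (hx : S.LPFeasible x w) (i : S.R)
    (m : Fin (S.data i).numPrimitives) : x i m ≤ 1 :=
  (Finset.single_le_sum (fun m _ => hx.nonneg i m) (Finset.mem_univ m)).trans (hx.packing i)

theorem LPFeasible.add_le_one {x : S.Assignment} {w : ℝ} (hx : S.LPFeasible x w) (i : S.R)
    {m m' : Fin (S.data i).numPrimitives} (h : m ≠ m') : x i m + x i m' ≤ 1 := by
  rw [← Finset.sum_pair h]
  exact (Finset.sum_le_univ_sum_of_nonneg fun m => hx.nonneg i m).trans (hx.packing i)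

theorem LPFeasible.demand_le {x : S.Assignment} {w : ℝ} (hx : S.LPFeasible x w)
    {u : S.Primitive → ℝ} (hu : ∀ p, x p.1 p.2 ≤ u p) (p : S.Primitive) :
    S.demand (fun _ => w) u p ≤ x p.1 p.2 := by
  refine (Finset.fold_max_le _).2 ⟨hx.nonneg _ _, fun j hj => ?_⟩
  rcases (weight_nonneg p j).eq_or_lt with h0 | h0
  · rw [← h0, div_zero]
    exact hx.nonneg _ _
  · rw [div_le_iff₀ h0]
    have h1 := hx.le_sum_weight (S.RS_subset _ _ hj)
    rw [← Finset.add_sum_erase _ _ (Finset.mem_univ p)] at h1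
    have h2 : ∑ q ∈ Finset.univ.erase p, S.weight q j * x q.1 q.2
        ≤ ∑ q ∈ Finset.univ.erase p, S.weight q j * u q :=
      Finset.sum_le_sum fun q _ => mul_le_mul_of_nonneg_left (hu q) (weight_nonneg q j)
    linarith

theorem LPFeasible.le_upper {x : S.Assignment} {w : ℝ} (hx : S.LPFeasible x w) (d : ℕ)
    (p : S.Primitive) : x p.1 p.2 ≤ S.upper (fun _ => w) d p := by
  induction d generalizing p with
  | zero => exact hx.le_one _ _
  | succ d ih =>
    rw [upper, capacity, le_sub_comm]
    refine (Finset.fold_max_le _).2 ⟨by linarith [hx.le_one p.1 p.2], fun m hm => ?_⟩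
    have h1 := hx.add_le_one p.1 (Finset.ne_of_mem_erase hm)
    have h2 := hx.demand_le ih ⟨p.1, m⟩
    linarith

theorem LPFeasible.lower_le_upper {x : S.Assignment} {w : ℝ} (hx : S.LPFeasible x w) (d : ℕ)
    (p : S.Primitive) : S.lower (fun _ => w) d p ≤ S.upper (fun _ => w) d p :=
  (hx.demand_le (hx.le_upper d) p).trans (hx.le_upper d p)

theorem LPFeasible.mem_consistent {x : S.Assignment} {w : ℝ} (hx : S.LPFeasible x w) (h : ℕ)
    (i : S.R) : w ∈ S.consistent h i :=
  fun d _ m => hx.lower_le_upper d ⟨i, m⟩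

theorem lpFeasible_zero (S : SATAInstance) : S.LPFeasible (fun _ _ => 0) 0 where
  packing := by simp
  covering := by simp
  nonneg := by simp

/-! ### Consistent values and thresholds -/

theorem continuous_demand {u : ℝ → S.Primitive → ℝ} (hu : ∀ p, Continuous fun ω => u ω p)
    (p : S.Primitive) : Continuous fun ω => S.demand (fun _ => ω) (u ω) p := by
  refine Continuous.finset_fold_max fun j _ => Continuous.div_const ?_ _
  exact continuous_id.sub (continuous_finsetSum _ fun q _ => continuous_const.mul (hu q))

theorem continuous_upper (d : ℕ) (p : S.Primitive) :
    Continuous fun ω : ℝ => S.upper (fun _ => ω) d p := by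
  induction d generalizing p with
  | zero => exact continuous_const
  | succ d ih =>
    exact continuous_const.sub (Continuous.finset_fold_max fun m _ => continuous_demand ih _)

theorem isClosed_consistent (h : ℕ) (i : S.R) : IsClosed (S.consistent h i) := by
  simp only [consistent, Set.ofPred_forall]
  exact isClosed_iInter fun d => isClosed_iInter fun _ => isClosed_iInter fun m =>
    isClosed_le (continuous_demand (continuous_upper d) _) (continuous_upper d _)

/-- A consistent value is at most the total weight of each target that the robot can help to cover:
this is what `lower 0 ≤ 1` says. -/
theorem bddAbove_consistent {h : ℕ} (hh : 1 ≤ h) {p : S.Primitive} {j : ℕ}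
    (hp : 0 < S.weight p j) : BddAbove (S.consistent h p.1) := by
  refine ⟨∑ q, S.weight q j, fun ω hω => ?_⟩
  have h1 := (hω 0 hh p.2).trans (upper_le_one _ _ _)
  have h2 := sub_sum_le_weight_mul_demand (fun _ => ω) (S.upper (fun _ => ω) 0) hp
  have h3 : S.weight p j * S.demand (fun _ => ω) (S.upper (fun _ => ω) 0) p ≤ S.weight p j :=
    mul_le_of_le_one_right hp.le h1
  rw [← Finset.add_sum_erase _ _ (Finset.mem_univ p)]
  simp only [upper, mul_one] at h2 h3
  linarith

theorem Near.refl (k : ℕ) (i : S.R) : S.Near k i i := ⟨.nil, Nat.zero_le k⟩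

theorem Near.symm {k : ℕ} {i l : S.R} (h : S.Near k i l) : S.Near k l i := by
  obtain ⟨w, hw⟩ := h
  exact ⟨w.reverse, by simpa using hw⟩

theorem Near.mono {k k' : ℕ} (hk : k ≤ k') {i l : S.R} (h : S.Near k i l) : S.Near k' i l := by
  obtain ⟨w, hw⟩ := h
  exact ⟨w, hw.trans hk⟩

theorem near_succ_iff {k : ℕ} {i l : S.R} :
    S.Near (k + 1) i l ↔ S.Near k i l ∨ ∃ i', S.comm.Adj i i' ∧ S.Near k i' l := by
  constructor
  · rintro ⟨w, hw⟩
    cases w with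
    | nil => exact Or.inl (Near.refl k i)
    | cons hadj w' => exact Or.inr ⟨_, hadj, w', by simpa using hw⟩
  · rintro (h | ⟨i', hadj, w, hw⟩)
    · exact h.mono k.le_succ
    · exact ⟨.cons hadj w, by simpa using hw⟩

theorem near_zero_iff {i l : S.R} : S.Near 0 i l ↔ i = l := by
  constructor
  · rintro ⟨w, hw⟩
    exact SimpleGraph.Walk.eq_of_length_eq_zero (Nat.le_zero.1 hw)
  · rintro rfl
    exact Near.refl 0 i

theorem threshold_mem_consistent {h : ℕ} {i l : S.R} (hil : S.Near h i l) :
    S.threshold h i ∈ S.consistent h l := by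
  set Ω : Set ℝ := {ω | ∀ l, S.Near h i l → ω ∈ S.consistent h l} with hΩ
  have h0 : (0 : ℝ) ∈ Ω := fun l _ => S.lpFeasible_zero.mem_consistent h l
  have hclosed : IsClosed Ω := by
    simp only [hΩ, Set.ofPred_forall]
    exact isClosed_iInter fun l => isClosed_iInter fun _ => isClosed_consistent h l
  have hmem : S.threshold h i ∈ Ω := by
    by_cases hb : BddAbove Ω
    · exact hclosed.csSup_mem ⟨0, h0⟩ hb
    · rw [threshold, Real.sSup_of_not_bddAbove hb]
      exact h0
  exact hmem l hil

/-- The positive weight matters: without one near the robot, its threshold is the default `0`. -/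
theorem LPFeasible.le_threshold {x : S.Assignment} {w : ℝ} (hx : S.LPFeasible x w) {h : ℕ}
    (hh : 1 ≤ h) {p : S.Primitive} {j : ℕ} (hp : 0 < S.weight p j) :
    w ≤ S.threshold h p.1 :=
  le_csSup ((bddAbove_consistent hh hp).mono fun _ hω => hω _ (Near.refl h p.1))
    fun l _ => hx.mem_consistent h l

/-! ### Monotonicity of the bounds in the requested values -/

theorem demand_mono {s s' : S.R → ℝ} {u u' : S.Primitive → ℝ} {p : S.Primitive}
    (hs : s p.1 ≤ s' p.1)
    (hu : ∀ q : S.Primitive, p.1 = q.1 ∨ S.comm.Adj p.1 q.1 → u' q ≤ u q) :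
    S.demand s u p ≤ S.demand s' u' p := by
  refine Finset.fold_max_zero_mono fun j hj => ?_
  refine div_le_div_of_nonneg_right (sub_le_sub hs (Finset.sum_le_sum fun q _ => ?_))
    (weight_nonneg p j)
  rcases (weight_nonneg q j).eq_or_lt with h0 | h0
  · simp [← h0]
  · exact mul_le_mul_of_nonneg_left
      (hu q (eq_or_adj_of_mem_RS hj (mem_RS_of_weight_pos h0))) h0.le

theorem capacity_anti {v v' : S.Primitive → ℝ} {p : S.Primitive}
    (h : ∀ m, v ⟨p.1, m⟩ ≤ v' ⟨p.1, m⟩) : S.capacity v' p ≤ S.capacity v p :=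
  sub_le_sub_left (Finset.fold_max_zero_mono fun m _ => h m) 1

/-- The bounds at `p` depend only on the values requested within `d` hops, and monotonically. -/
theorem lower_mono_of_near {s s' : S.R → ℝ} (d : ℕ) (p : S.Primitive)
    (hs : ∀ l, S.Near d p.1 l → s l ≤ s' l) : S.lower s d p ≤ S.lower s' d p := by
  induction d generalizing p with
  | zero => exact demand_mono (hs _ (Near.refl 0 _)) fun _ _ => le_rfl
  | succ d ih =>
    refine demand_mono (hs _ (Near.refl _ _)) fun q hq => capacity_anti fun m => ih _ fun l hl => ?_
    refine hs l (near_succ_iff.2 ?_)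
    rcases hq with h | h
    · exact Or.inl (h ▸ hl)
    · exact Or.inr ⟨_, h, hl⟩

theorem upper_anti_of_near {s s' : S.R → ℝ} (d : ℕ) (p : S.Primitive)
    (hs : ∀ l, S.Near d p.1 l → s l ≤ s' l) : S.upper s' d p ≤ S.upper s d p := by
  cases d with
  | zero => exact le_rfl
  | succ d =>
    exact capacity_anti fun m => lower_mono_of_near d _ fun l hl => hs l (hl.mono d.le_succ)

/-- The bounds computed with the thresholds do not contradict each other, because they are wider than
the bounds for the constant request that equals the largest threshold nearby. -/
theorem lower_threshold_le_upper_threshold {h d : ℕ} (hd : d < h) (p : S.Primitive) :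
    S.lower (S.threshold h) d p ≤ S.upper (S.threshold h) d p := by
  classical
  obtain ⟨i, hi, hmax⟩ := Finset.exists_max_image (Finset.univ.filter (S.Near h p.1))
    (S.threshold h) ⟨p.1, by simp [Near.refl]⟩
  simp only [Finset.mem_filter, Finset.mem_univ, true_and] at hi hmax
  have hle : ∀ l, S.Near d p.1 l → S.threshold h l ≤ S.threshold h i :=
    fun l hl => hmax l (hl.mono hd.le)
  calc S.lower (S.threshold h) d p
      ≤ S.lower (fun _ => S.threshold h i) d p := lower_mono_of_near d p hle
    _ ≤ S.upper (fun _ => S.threshold h i) d p := threshold_mem_consistent hi.symm d hd p.2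
    _ ≤ S.upper (S.threshold h) d p := upper_anti_of_near d p hle

/-! ### Packing constraints -/

/-- Only the first `a` and the last `b` are left over when `b d` is paired with `a (d + 1)`. -/
theorem sum_shifted_le {a b : ℕ → ℝ} (ha : a 0 ≤ 1) (hab : ∀ d, a (d + 1) + b d ≤ 1) {h : ℕ}
    (hh : 1 ≤ h) (hb : ∀ d < h, b d ≤ 1) : ∑ d ∈ Finset.range h, (a d + b d) ≤ h + 1 := by
  obtain ⟨r, rfl⟩ : ∃ r, h = r + 1 := ⟨h - 1, by omega⟩
  rw [Finset.sum_add_distrib, Finset.sum_range_succ' a, Finset.sum_range_succ b]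
  have h1 : ∑ d ∈ Finset.range r, a (d + 1) + ∑ d ∈ Finset.range r, b d ≤ r := by
    rw [← Finset.sum_add_distrib]
    exact (Finset.sum_le_sum fun d _ => hab d).trans (by simp)
  have h2 := hb r (Nat.lt_succ_self r)
  push_cast
  linarith

theorem levelSum_nonneg (h : ℕ) (p : S.Primitive) : 0 ≤ S.levelSum h p :=
  Finset.sum_nonneg fun d hd =>
    add_nonneg ((lower_nonneg _ d p).trans
      (lower_threshold_le_upper_threshold (Finset.mem_range.1 hd) p)) (lower_nonneg _ d p)

theorem levelSum_le (h : ℕ) (p : S.Primitive) : S.levelSum h p ≤ 2 * h := by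
  refine (Finset.sum_le_card_nsmul _ _ 2 fun d hd => ?_).trans (by simp [mul_comm])
  linarith [upper_le_one (S.threshold h) d p,
    lower_threshold_le_upper_threshold (Finset.mem_range.1 hd) p]

theorem levelSum_add_le {h : ℕ} (hh : 1 ≤ h) {i : S.R} {m m' : Fin (S.data i).numPrimitives}
    (hm : m ≠ m') : S.levelSum h ⟨i, m⟩ + S.levelSum h ⟨i, m'⟩ ≤ 2 * (h + 1) := by
  have key : ∀ m m' : Fin (S.data i).numPrimitives, m ≠ m' →
      ∑ d ∈ Finset.range h, (S.upper (S.threshold h) d ⟨i, m⟩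
        + S.lower (S.threshold h) d ⟨i, m'⟩) ≤ h + 1 := fun m m' hm =>
    sum_shifted_le (a := fun d => S.upper (S.threshold h) d ⟨i, m⟩)
      (b := fun d => S.lower (S.threshold h) d ⟨i, m'⟩) le_rfl
      (fun d => capacity_add_le_one _ hm.symm) hh
      fun d hd => (lower_threshold_le_upper_threshold hd _).trans (upper_le_one _ _ _)
  have h1 := key m m' hm
  have h2 := key m' m hm.symm
  simp only [levelSum, Finset.sum_add_distrib] at h1 h2 ⊢
  linarith

theorem sum_le_of_pairwise_add_le {n : ℕ} (hn : 2 ≤ n) {Y : Fin n → ℝ} {B : ℝ}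
    (hY : ∀ m m', m ≠ m' → Y m + Y m' ≤ B) : ∑ m, Y m ≤ n * B / 2 := by
  -- The constraints of the pairs containing `m`, added up.
  have h1 : ∀ m, ((n : ℝ) - 2) * Y m + ∑ m', Y m' ≤ ((n : ℝ) - 1) * B := by
    intro m
    have h2 : ∑ m' ∈ Finset.univ.erase m, (Y m + Y m') ≤ ((n : ℝ) - 1) * B := by
      refine (Finset.sum_le_card_nsmul _ _ B fun m' hm' =>
        hY m m' (Finset.ne_of_mem_erase hm').symm).trans_eq ?_
      rw [Finset.card_erase_of_mem (Finset.mem_univ m), Finset.card_univ, Fintype.card_fin,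
        nsmul_eq_mul, Nat.cast_sub (by omega), Nat.cast_one]
    rw [← Finset.add_sum_erase _ Y (Finset.mem_univ m)]
    rw [Finset.sum_add_distrib, Finset.sum_const, Finset.card_erase_of_mem (Finset.mem_univ m),
      Finset.card_univ, Fintype.card_fin, nsmul_eq_mul, Nat.cast_sub (by omega),
      Nat.cast_one] at h2
    linarith
  have h3 := Finset.sum_le_sum fun m (_ : m ∈ Finset.univ) => h1 m
  rw [Finset.sum_add_distrib, ← Finset.mul_sum, Finset.sum_const, Finset.sum_const,
    Finset.card_univ, Fintype.card_fin, nsmul_eq_mul, nsmul_eq_mul] at h3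
  have hn' : (2 : ℝ) ≤ n := by exact_mod_cast hn
  have h4 : ((n : ℝ) - 1) * (2 * ∑ m, Y m) ≤ ((n : ℝ) - 1) * (n * B) := by linarith
  linarith [le_of_mul_le_mul_left h4 (by linarith)]

theorem averaged_nonneg (h : ℕ) (i : S.R) (m : Fin (S.data i).numPrimitives) :
    0 ≤ S.averaged h i m :=
  mul_nonneg (by positivity) (levelSum_nonneg h _)

theorem sum_averaged_le_one {h : ℕ} (hh : 1 ≤ h) (i : S.R) :
    ∑ m, S.averaged h i m ≤ 1 := by
  set n := (S.data i).numPrimitives with hn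
  have hh' : (0 : ℝ) < 2 * ((h : ℝ) + 1) := by positivity
  simp only [averaged, ← Finset.mul_sum]
  rw [div_mul_eq_mul_div, div_le_one hh']
  rcases Nat.lt_or_ge n 2 with h2 | h2
  · have h3 : ∑ m, S.levelSum h ⟨i, m⟩ ≤ 2 * h := by
      refine (Finset.sum_le_card_nsmul _ _ (2 * (h : ℝ)) fun m _ => levelSum_le h _).trans ?_
      rw [Finset.card_univ, Fintype.card_fin, nsmul_eq_mul]
      have : (n : ℝ) ≤ 1 := by exact_mod_cast Nat.lt_succ_iff.1 h2
      exact mul_le_of_le_one_left (by positivity) this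
    have h4 : 0 ≤ ∑ m, S.levelSum h ⟨i, m⟩ := Finset.sum_nonneg fun m _ => levelSum_nonneg h _
    have h5 := mul_le_of_le_one_left h4 (min_le_left 1 (2 / (n : ℝ)))
    linarith
  · have h3 := sum_le_of_pairwise_add_le h2 fun m m' hm => levelSum_add_le (i := i) hh hm
    have h4 : 0 ≤ ∑ m, S.levelSum h ⟨i, m⟩ := Finset.sum_nonneg fun m _ => levelSum_nonneg h _
    have hn0 : (0 : ℝ) < n := by exact_mod_cast (by omega : 0 < n)
    calc _ ≤ 2 / (n : ℝ) * ∑ m, S.levelSum h ⟨i, m⟩ :=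
          mul_le_mul_of_nonneg_right (min_le_right _ _) h4
      _ ≤ 2 / (n : ℝ) * (n * (2 * ((h : ℝ) + 1)) / 2) :=
          mul_le_mul_of_nonneg_left h3 (by positivity)
      _ = 2 * ((h : ℝ) + 1) := by field_simp

/-! ### Covering constraints -/

theorem card_weight_pos_le (S : SATAInstance) {j : ℕ} (hj : j ∈ S.T) :
    (Finset.univ.filter fun p : S.Primitive => 0 < S.weight p j).card
      ≤ S.maxPrimitivesPerTarget :=
  (Finset.card_le_card (Finset.monotone_filter_right _
    fun _ _ hp => mem_RS_of_weight_pos hp)).trans (Finset.le_sup (f := S.numSeeing) hj)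

theorem numPrimitives_le (S : SATAInstance) (i : S.R) :
    (S.data i).numPrimitives ≤ S.maxPrimitivesPerRobot :=
  Finset.le_sup (f := fun i : S.R => (S.data i).numPrimitives) (Finset.mem_univ i)

/-- Each level of the recursion covers each target at least `ΔT / (ΔT - 1)` times as well as any
feasible solution. -/
theorem LPFeasible.le_sum_upper_add_lower {x : S.Assignment} {w : ℝ} (hx : S.LPFeasible x w)
    (hw : 0 < w) {h d : ℕ} (hd : d < h) {ΔT : ℕ} (hΔ : 2 ≤ ΔT)
    (hS : S.maxPrimitivesPerTarget ≤ ΔT) {j : ℕ} (hj : j ∈ S.T) :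
    (ΔT : ℝ) * w ≤ ((ΔT : ℝ) - 1) * ∑ p, S.weight p j *
      (S.upper (S.threshold h) d p + S.lower (S.threshold h) d p) := by
  set u := S.upper (S.threshold h) d
  set v := S.lower (S.threshold h) d with hv
  set P := Finset.univ.filter fun p : S.Primitive => 0 < S.weight p j with hP
  have hrestrict : ∀ f : S.Primitive → ℝ,
      ∑ p, S.weight p j * f p = ∑ p ∈ P, S.weight p j * f p := by
    intro f
    refine (Finset.sum_subset (Finset.subset_univ P) fun p _ hp => ?_).symm
    have : S.weight p j = 0 := by
      have h1 : ¬ 0 < S.weight p j := by simpa [hP] using hp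
      exact le_antisymm (not_lt.1 h1) (weight_nonneg p j)
    simp [this]
  set G := ∑ p, S.weight p j * u p with hG
  set L := ∑ p, S.weight p j * v p with hL
  -- The demand of the target at `p`, the other primitives being at their upper bounds.
  have hpt : ∀ p ∈ P, w - G + S.weight p j * u p ≤ S.weight p j * v p := by
    intro p hp
    have hp' : 0 < S.weight p j := by simpa [hP] using hp
    have h1 := sub_sum_le_weight_mul_demand (S.threshold h) u hp'
    have h2 := hx.le_threshold (by omega : 1 ≤ h) hp'
    have h3 := Finset.add_sum_erase Finset.univ (fun q => S.weight q j * u q) (Finset.mem_univ p)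
    change _ ≤ S.weight p j * v p at h1
    linarith
  have hne : P.Nonempty := by
    by_contra hne
    rw [Finset.not_nonempty_iff_eq_empty] at hne
    have h1 := hx.le_sum_weight hj
    rw [hrestrict fun p => x p.1 p.2, hne, Finset.sum_empty] at h1
    linarith
  -- For targets seen by a single primitive, this is where `lower ≤ upper` is indispensable.
  have hGw : w ≤ G := by
    obtain ⟨p, hp⟩ := hne
    have h1 := hpt p hp
    have h2 := mul_le_mul_of_nonneg_left
      (lower_threshold_le_upper_threshold hd p) (weight_nonneg p j)
    linarith
  have hcard : (P.card : ℝ) ≤ ΔT := by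
    exact_mod_cast (S.card_weight_pos_le hj).trans hS
  have hLP : P.card * (w - G) + G ≤ L := by
    have h1 := Finset.sum_le_sum hpt
    rw [Finset.sum_add_distrib, Finset.sum_const, nsmul_eq_mul, ← hrestrict, ← hrestrict] at h1
    exact h1
  have hL0 : 0 ≤ L := Finset.sum_nonneg fun p _ =>
    mul_nonneg (weight_nonneg p j) (lower_nonneg _ d p)
  have hsum : ∑ p, S.weight p j * (u p + v p) = G + L := by
    simp only [mul_add, Finset.sum_add_distrib, hG, hL]
  have hΔ' : (2 : ℝ) ≤ ΔT := by exact_mod_cast hΔ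
  have h1 : (P.card : ℝ) * (G - w) ≤ ΔT * (G - w) :=
    mul_le_mul_of_nonneg_right hcard (by linarith)
  have h2 : 0 ≤ ((ΔT : ℝ) - 2) * L := mul_nonneg (by linarith) hL0
  rw [hsum]
  linarith

theorem LPFeasible.le_mul_sum_averaged {x : S.Assignment} {w : ℝ} (hx : S.LPFeasible x w)
    (hw : 0 < w) {h : ℕ} (hh : 1 ≤ h) {ΔR ΔT : ℕ} (hΔR : 2 ≤ ΔR) (hΔT : 2 ≤ ΔT)
    (hR : S.maxPrimitivesPerRobot ≤ ΔR) (hT : S.maxPrimitivesPerTarget ≤ ΔT) {j : ℕ}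
    (hj : j ∈ S.T) :
    w ≤ (ΔR : ℝ) * (1 + 1 / (h : ℝ)) * (1 - 1 / (ΔT : ℝ)) *
      ∑ i, ∑ m, (S.data i).c m j * S.averaged h i m := by
  have hR' : (2 : ℝ) ≤ ΔR := by exact_mod_cast hΔR
  have hT' : (2 : ℝ) ≤ ΔT := by exact_mod_cast hΔT
  have hh' : (1 : ℝ) ≤ h := by exact_mod_cast hh
  set Y := ∑ p : S.Primitive, S.weight p j * S.levelSum h p with hY
  have h1 : (h : ℝ) * (ΔT * w) ≤ ((ΔT : ℝ) - 1) * Y := by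
    have h2 : Y = ∑ d ∈ Finset.range h, ∑ p, S.weight p j *
        (S.upper (S.threshold h) d p + S.lower (S.threshold h) d p) := by
      rw [Finset.sum_comm]
      simp only [hY, levelSum, Finset.mul_sum]
    have h3 := Finset.sum_le_sum fun d (hd : d ∈ Finset.range h) =>
      hx.le_sum_upper_add_lower hw (Finset.mem_range.1 hd) hΔT hT hj
    rwa [Finset.sum_const, Finset.card_range, nsmul_eq_mul, ← Finset.mul_sum, ← h2] at h3
  have h4 : 1 / (ΔR * ((h : ℝ) + 1)) * Y ≤ ∑ i, ∑ m, (S.data i).c m j * S.averaged h i m := by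
    rw [hY, Fintype.sum_sigma, Finset.mul_sum]
    refine Finset.sum_le_sum fun i _ => ?_
    rw [Finset.mul_sum]
    refine Finset.sum_le_sum fun m _ => ?_
    have hn0 : (0 : ℝ) < (S.data i).numPrimitives := by exact_mod_cast Fin.pos m
    have hn : ((S.data i).numPrimitives : ℝ) ≤ ΔR := by
      exact_mod_cast (S.numPrimitives_le i).trans hR
    have h5 : 2 / (ΔR : ℝ) ≤ min 1 (2 / ((S.data i).numPrimitives : ℝ)) :=
      le_min ((div_le_one (by linarith)).2 hR') (div_le_div_of_nonneg_left zero_le_two hn0 hn)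
    have h6 : 1 / (ΔR * ((h : ℝ) + 1)) = 2 / (ΔR : ℝ) / (2 * ((h : ℝ) + 1)) := by
      field_simp
    have h7 := div_le_div_of_nonneg_right h5 (by positivity : 0 ≤ 2 * ((h : ℝ) + 1))
    have h8 := mul_nonneg ((S.data i).c_nonneg m j) (levelSum_nonneg h ⟨i, m⟩)
    rw [h6, averaged]
    calc _ ≤ _ := mul_le_mul_of_nonneg_right h7 h8
      _ = _ := by ring
  have hρ : 0 ≤ (ΔR : ℝ) * (1 + 1 / (h : ℝ)) * (1 - 1 / (ΔT : ℝ)) := by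
    have : 1 / (ΔT : ℝ) ≤ 1 := (div_le_one (by linarith)).2 (by linarith)
    exact mul_nonneg (by positivity) (by linarith)
  refine le_trans ?_ (mul_le_mul_of_nonneg_left h4 hρ)
  have h9 : (ΔR : ℝ) * (1 + 1 / (h : ℝ)) * (1 - 1 / (ΔT : ℝ)) *
      (1 / (ΔR * ((h : ℝ) + 1)) * Y) = ((ΔT : ℝ) - 1) * Y / (h * ΔT) := by
    field_simp
  rw [h9, le_div_iff₀ (by positivity)]
  linarith

/-! ### Approximation ratios -/

/-- Feasible values `w' ≤ 0` need no attention since an assignment with nonnegative entries has a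
nonnegative value. -/
theorem IsApproxSolution.of_forall {ρ : ℝ} (hρ : 0 ≤ ρ) {x : S.Assignment}
    (hpack : ∀ i, ∑ m, x i m ≤ 1) (hnonneg : ∀ i m, 0 ≤ x i m)
    (hcov : ∀ x' w', S.LPFeasible x' w' → 0 < w' → ∀ j ∈ S.T,
      w' ≤ ρ * ∑ i, ∑ m, (S.data i).c m j * x i m) :
    S.IsApproxSolution ρ x := by
  obtain ⟨j, hj, hmin⟩ := Finset.exists_min_image S.T
    (fun j => ∑ i, ∑ m, (S.data i).c m j * x i m) S.T_nonempty
  refine ⟨∑ i, ∑ m, (S.data i).c m j * x i m, ⟨hpack, hmin, hnonneg⟩, fun x' w' hx' => ?_⟩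
  rcases le_or_gt w' 0 with h0 | h0
  · exact h0.trans (mul_nonneg hρ (Finset.sum_nonneg fun i _ => Finset.sum_nonneg fun m _ =>
      mul_nonneg ((S.data i).c_nonneg m j) (hnonneg i m)))
  · exact hcov x' w' hx' h0 j hj

theorem isApproxSolution_averaged {h : ℕ} (hh : 1 ≤ h) {ΔR ΔT : ℕ} (hΔR : 2 ≤ ΔR)
    (hΔT : 2 ≤ ΔT) (hR : S.maxPrimitivesPerRobot ≤ ΔR) (hT : S.maxPrimitivesPerTarget ≤ ΔT)
    {ρ : ℝ} (hρ : (ΔR : ℝ) * (1 + 1 / (h : ℝ)) * (1 - 1 / (ΔT : ℝ)) ≤ ρ) :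
    S.IsApproxSolution ρ (S.averaged h) := by
  have hρ0 : 0 ≤ (ΔR : ℝ) * (1 + 1 / (h : ℝ)) * (1 - 1 / (ΔT : ℝ)) := by
    have : 1 / (ΔT : ℝ) ≤ 1 := (div_le_one (by positivity)).2 (by exact_mod_cast (by omega))
    exact mul_nonneg (by positivity) (by linarith)
  refine .of_forall (hρ0.trans hρ) (sum_averaged_le_one hh) (averaged_nonneg h)
    fun x' w' hx' hw' j hj => ?_
  refine (hx'.le_mul_sum_averaged hw' hh hΔR hΔT hR hT hj).trans
    (mul_le_mul_of_nonneg_right hρ ?_)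
  exact Finset.sum_nonneg fun i _ => Finset.sum_nonneg fun m _ =>
    mul_nonneg ((S.data i).c_nonneg m j) (averaged_nonneg h i m)

theorem isApproxSolution_uniform {ΔR : ℕ} (hR : S.maxPrimitivesPerRobot ≤ ΔR) {ρ : ℝ}
    (hρ : (ΔR : ℝ) ≤ ρ) :
    S.IsApproxSolution ρ fun i _ => 1 / ((S.data i).numPrimitives : ℝ) := by
  refine .of_forall ((Nat.cast_nonneg _).trans hρ) (fun i => ?_) (fun i m => by positivity)
    fun x' w' hx' _ j hj => (hx'.covering j hj).trans ?_
  · rw [Finset.sum_const, Finset.card_univ, Fintype.card_fin, nsmul_eq_mul, mul_one_div]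
    exact div_self_le_one _
  · rw [Finset.mul_sum]
    refine Finset.sum_le_sum fun i _ => ?_
    rw [Finset.mul_sum]
    refine Finset.sum_le_sum fun m _ => ?_
    have hn0 : (0 : ℝ) < (S.data i).numPrimitives := by exact_mod_cast Fin.pos m
    have hn : ((S.data i).numPrimitives : ℝ) ≤ ρ :=
      le_trans (by exact_mod_cast (S.numPrimitives_le i).trans hR) hρ
    have h1 : 1 ≤ ρ * (1 / ((S.data i).numPrimitives : ℝ)) := by
      rw [mul_one_div]
      exact (one_le_div hn0).2 hn
    have hc := (S.data i).c_nonneg m j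
    calc (S.data i).c m j * x' i m ≤ (S.data i).c m j * 1 :=
          mul_le_mul_of_nonneg_left (hx'.le_one i m) hc
      _ ≤ (S.data i).c m j * (ρ * (1 / ((S.data i).numPrimitives : ℝ))) :=
          mul_le_mul_of_nonneg_left h1 hc
      _ = _ := by ring

end SATAInstance

/-! ### Local computability -/

/-- The type of everything that a robot can know after `t` rounds: its label and data at first, and
then, added in each round, what its neighbours knew before that round. -/
def View : ℕ → Type
  | 0 => ℕ × RobotData
  | t + 1 => View t × Set (ℕ × View t)

namespace SATAInstance

/-- What the robot `i` knows after `t` rounds if all robots always send all they know. -/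
def view (S : SATAInstance) : (t : ℕ) → S.R → View t
  | 0, i => ((i : ℕ), S.data i)
  | t + 1, i => (S.view t i, {p | ∃ l : S.R, S.comm.Adj i l ∧ p = ((l : ℕ), S.view t l)})

/-- The values of `u` on the primitives of the robot `i`, extended by `0` to a sequence in order that
their type does not depend on the robot. -/
def values (S : SATAInstance) (u : S.Primitive → ℝ) (i : S.R) (k : ℕ) : ℝ :=
  if hk : k < (S.data i).numPrimitives then u ⟨i, ⟨k, hk⟩⟩ else 0

@[simp]
theorem values_coe (S : SATAInstance) (u : S.Primitive → ℝ) (i : S.R)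
    (m : Fin (S.data i).numPrimitives) : S.values u i m = u ⟨i, m⟩ := by
  simp [values]

end SATAInstance

/-- The quantity `F` of each robot is a function of its view after `t` rounds, the same function for
all robots of all instances. -/
def LocallyComputable {α : Type*} (t : ℕ) (F : (S : SATAInstance) → S.R → α) : Prop :=
  ∃ φ : View t → α, ∀ S i, F S i = φ (S.view t i)

namespace LocallyComputable

variable {α β : Type*} {t : ℕ} {F : (S : SATAInstance) → S.R → α}
  {G : (S : SATAInstance) → S.R → β}

theorem const (a : α) : LocallyComputable t fun _ _ => a :=
  ⟨fun _ => a, fun _ _ => rfl⟩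

theorem congr (hF : LocallyComputable t F) {F' : (S : SATAInstance) → S.R → α}
    (h : ∀ S i, F' S i = F S i) : LocallyComputable t F' := by
  obtain ⟨φ, hφ⟩ := hF
  exact ⟨φ, fun S i => (h S i).trans (hφ S i)⟩

theorem map (hF : LocallyComputable t F) (g : α → β) :
    LocallyComputable t fun S i => g (F S i) := by
  obtain ⟨φ, hφ⟩ := hF
  exact ⟨fun v => g (φ v), fun S i => congrArg g (hφ S i)⟩

theorem map₂ {γ : Type*} (hF : LocallyComputable t F) (hG : LocallyComputable t G)
    (g : α → β → γ) : LocallyComputable t fun S i => g (F S i) (G S i) := by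
  obtain ⟨φ, hφ⟩ := hF
  obtain ⟨ψ, hψ⟩ := hG
  exact ⟨fun v => g (φ v) (ψ v), fun S i => congrArg₂ g (hφ S i) (hψ S i)⟩

theorem pi {κ : Type*} {F : κ → (S : SATAInstance) → S.R → α}
    (hF : ∀ k, LocallyComputable t (F k)) : LocallyComputable t fun S i k => F k S i := by
  choose φ hφ using hF
  exact ⟨fun v k => φ k v, fun S i => funext fun k => hφ k S i⟩

theorem succ (hF : LocallyComputable t F) : LocallyComputable (t + 1) F := by
  obtain ⟨φ, hφ⟩ := hF
  exact ⟨fun v => φ v.1, hφ⟩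

theorem mono {t' : ℕ} (ht : t ≤ t') (hF : LocallyComputable t F) : LocallyComputable t' F := by
  induction ht with
  | refl => exact hF
  | step _ ih => exact ih.succ

theorem data (t : ℕ) : LocallyComputable t fun S i => S.data i :=
  mono (Nat.zero_le t) ⟨fun v : ℕ × RobotData => v.2, fun _ _ => rfl⟩

theorem neighbors (hF : LocallyComputable t F) : LocallyComputable (t + 1) fun S i =>
    {p : ℕ × α | ∃ l : S.R, S.comm.Adj i l ∧ p = ((l : ℕ), F S l)} := by
  obtain ⟨φ, hφ⟩ := hF
  refine ⟨fun v => Prod.map id φ '' v.2, fun S i => ?_⟩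
  ext ⟨k, a⟩
  constructor
  · rintro ⟨l, hl, h⟩
    exact ⟨_, ⟨l, hl, rfl⟩, by rw [h, hφ]; rfl⟩
  · rintro ⟨_, ⟨l, hl, rfl⟩, h⟩
    exact ⟨l, hl, by rw [← h, hφ]; rfl⟩

/-- A sum over all robots is found in one round if robots that do not communicate contribute nothing.
The labels of the senders keep equal messages of different neighbours apart. -/
theorem sum (hF : LocallyComputable t F) (hG : LocallyComputable t G) (K : β → α → ℝ)
    (hK : ∀ (S : SATAInstance) (i l : S.R), i ≠ l → ¬ S.comm.Adj i l → K (G S i) (F S l) = 0) :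
    LocallyComputable (t + 1) fun S i => ∑ l, K (G S i) (F S l) := by
  have h := (map₂ hF hG fun a b => (K b a, b)).succ.map₂ hF.neighbors
    fun p N => p.1 + ∑ᶠ q ∈ N, K p.2 q.2
  refine h.congr fun S i => ?_
  classical
  have hN : {p : ℕ × α | ∃ l : S.R, S.comm.Adj i l ∧ p = ((l : ℕ), F S l)}
      = (fun l : S.R => ((l : ℕ), F S l)) ''
        ((Finset.univ.filter (S.comm.Adj i) : Finset S.R) : Set S.R) := by
    ext p
    simp [eq_comm]
  rw [hN, finsum_mem_image, finsum_mem_coe_finset,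
    ← Finset.add_sum_erase _ _ (Finset.mem_univ i)]
  · congr 1
    symm
    refine Finset.sum_subset (fun l hl => ?_) fun l hl hl' => ?_
    · have : S.comm.Adj i l := by simpa using hl
      simpa using this.ne'
    · exact hK S i l (Finset.ne_of_mem_erase hl).symm (by simpa using hl')
  · intro l _ l' _ h
    exact Subtype.ext (Prod.ext_iff.1 h).1

/-- Criterion for the values of a family on the primitives: each robot finds its own values from its
data and a locally computable quantity. -/
theorem values {u : (S : SATAInstance) → S.Primitive → ℝ} (hG : LocallyComputable t G)
    (Φ : (D : RobotData) → β → Fin D.numPrimitives → ℝ)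
    (hu : ∀ S i m, u S ⟨i, m⟩ = Φ (S.data i) (G S i) m) :
    LocallyComputable t fun S i => S.values (u S) i := by
  have h := (data t).map₂ hG fun D b k =>
    if hk : k < D.numPrimitives then Φ D b ⟨k, hk⟩ else 0
  refine h.congr fun S i => ?_
  funext k
  simp only [SATAInstance.values, hu]

variable {s : (S : SATAInstance) → S.R → ℝ} {u : (S : SATAInstance) → S.Primitive → ℝ}

theorem demand (hs : LocallyComputable t s)
    (hu : LocallyComputable t fun S i => S.values (u S) i) :
    LocallyComputable (t + 1) fun S i => S.values (S.demand (s S) (u S)) i := by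
  classical
  -- Restricting to targets that robot `i` sees makes all other contributing robots its neighbours.
  have hsum : LocallyComputable (t + 1) fun S i (j : ℕ) => ∑ l,
      if ∃ m, j ∈ (S.data i).RS m then
        ∑ m, (S.data l).c m j * S.values (u S) l m else 0 := by
    refine pi fun j => sum ((data t).map₂ hu Prod.mk) (data t)
      (fun D P => if ∃ m, j ∈ D.RS m then ∑ m, P.1.c m j * P.2 m else 0)
      fun S i l hil hadj => ?_
    dsimp only
    split_ifs with h
    · obtain ⟨m, hm⟩ := h
      refine Finset.sum_eq_zero fun m' _ => ?_
      rw [(S.data l).c_eq_zero m' j fun hm' =>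
        hadj (S.comm_range i l hil ⟨m, m', j, hm, hm'⟩), zero_mul]
    · rfl
  refine values ((hs.succ.map₂ hu.succ Prod.mk).map₂ hsum Prod.mk)
    (fun D b m => (D.RS m).fold max 0 fun j =>
      (b.1.1 - (b.2 j - D.c m j * b.1.2 m)) / D.c m j) fun S i m => ?_
  refine Finset.fold_congr fun j hj => ?_
  have h1 := Finset.add_sum_erase Finset.univ (fun q => S.weight q j * u S q)
    (Finset.mem_univ (⟨i, m⟩ : S.Primitive))
  rw [Fintype.sum_sigma] at h1
  simp only [SATAInstance.values_coe, if_pos (⟨m, hj⟩ : ∃ m, j ∈ (S.data i).RS m)]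
  simp only [SATAInstance.weight] at h1 ⊢
  rw [← h1, add_sub_cancel_left]

theorem capacity (hu : LocallyComputable t fun S i => S.values (u S) i) :
    LocallyComputable t fun S i => S.values (S.capacity (u S)) i :=
  values hu (fun _ b m => 1 - (Finset.univ.erase m).fold max 0 fun m' : Fin _ => b m')
    fun S i m => by simp [SATAInstance.capacity]

theorem upper (hs : LocallyComputable t s) (d : ℕ) :
    LocallyComputable (t + d) fun S i => S.values (S.upper (s S) d) i := by
  induction d with
  | zero => exact values (const ()) (fun _ _ _ => 1) fun _ _ _ => rfl
  | succ d ih => exact ((hs.mono (Nat.le_add_right t d)).demand ih).capacity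

theorem lower (hs : LocallyComputable t s) (d : ℕ) :
    LocallyComputable (t + d + 1) fun S i => S.values (S.lower (s S) d) i :=
  (hs.mono (Nat.le_add_right t d)).demand (hs.upper d)

/-- All values `ω` are tested in the same `h` rounds, the messages being functions of `ω`. -/
theorem consistent (h : ℕ) : LocallyComputable h fun S i => S.consistent h i := by
  have hω : ∀ ω : ℝ, LocallyComputable h fun S i => ω ∈ S.consistent h i := by
    intro ω
    have hc : LocallyComputable 0 fun (S : SATAInstance) (_ : S.R) => ω := const ω
    have hlow : LocallyComputable h fun S i (d : Fin h) =>
        S.values (S.lower (fun _ => ω) d) i :=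
      pi fun d => (hc.lower d).mono (by omega)
    have hupp : LocallyComputable h fun S i (d : Fin h) =>
        S.values (S.upper (fun _ => ω) d) i :=
      pi fun d => (hc.upper d).mono (by omega)
    have hall := (data h).map₂ (hlow.map₂ hupp Prod.mk) fun D b =>
      ∀ (d : Fin h) (m : Fin D.numPrimitives), b.1 d m ≤ b.2 d m
    refine hall.congr fun S i => ?_
    simp [SATAInstance.consistent, Fin.forall_iff]
  exact pi hω

theorem near {F : (S : SATAInstance) → S.R → Set ℝ} (hF : LocallyComputable t F) (k : ℕ) :
    LocallyComputable (t + k) fun S i => {ω | ∀ l, S.Near k i l → ω ∈ F S l} := by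
  induction k with
  | zero =>
    refine hF.congr fun S i => ?_
    ext ω
    simp [SATAInstance.near_zero_iff]
  | succ k ih =>
    have h := ih.succ.map₂ ih.neighbors fun A N => {ω | ω ∈ A ∧ ∀ q ∈ N, ω ∈ q.2}
    refine h.congr fun S i => ?_
    ext ω
    simp only [SATAInstance.near_succ_iff, Set.mem_ofPred_eq]
    constructor
    · intro h
      refine ⟨fun l hl => h l (Or.inl hl), ?_⟩
      rintro _ ⟨i', hi', rfl⟩ l hl
      exact h l (Or.inr ⟨i', hi', hl⟩)
    · rintro ⟨h1, h2⟩ l (hl | ⟨i', hi', hl⟩)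
      · exact h1 l hl
      · exact h2 _ ⟨i', hi', rfl⟩ l hl

theorem threshold (h : ℕ) : LocallyComputable (2 * h) fun S i => S.threshold h i :=
  ((consistent h).near h |>.map sSup).mono (by omega)

theorem averaged (h : ℕ) : LocallyComputable (3 * h) fun S i =>
    S.values (fun p => S.averaged h p.1 p.2) i := by
  have hlow : LocallyComputable (3 * h) fun S i (d : Fin h) =>
      S.values (S.lower (S.threshold h) d) i :=
    pi fun d => ((threshold h).lower d).mono (by omega)
  have hupp : LocallyComputable (3 * h) fun S i (d : Fin h) =>
      S.values (S.upper (S.threshold h) d) i :=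
    pi fun d => ((threshold h).upper d).mono (by omega)
  refine values (hupp.map₂ hlow Prod.mk) (fun D b m =>
    min 1 (2 / (D.numPrimitives : ℝ)) / (2 * ((h : ℝ) + 1)) * ∑ d, (b.1 d m + b.2 d m))
    fun S i m => ?_
  simp [SATAInstance.averaged, SATAInstance.levelSum, Finset.sum_range]

end LocallyComputable

/-! ### From local computability to algorithms -/

/-- The algorithm that collects the view for `t` rounds and then outputs `φ` of it. -/
def viewAlgorithm {t : ℕ} (φ : View t → ℕ → ℝ) : LocalAlgorithm where
  State := Σ k, View k
  Msg := Σ k, View k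
  init i D := ⟨0, (i, D)⟩
  send v := v
  step v N := ⟨v.1 + 1, (v.2, {p | (p.1, (⟨v.1, p.2⟩ : Σ k, View k)) ∈ N})⟩
  out v := if hv : v.1 = t then φ (hv ▸ v.2) else fun _ => 0

theorem viewAlgorithm_run {t : ℕ} (φ : View t → ℕ → ℝ) (S : SATAInstance) (k : ℕ) (i : S.R) :
    (viewAlgorithm φ).run S k i = (⟨k, S.view k i⟩ : Σ k, View k) := by
  induction k generalizing i with
  | zero => rfl
  | succ k ih =>
    simp only [LocalAlgorithm.run, ih]
    simp only [viewAlgorithm, SATAInstance.view]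
    congr 2
    ext ⟨a, v⟩
    simp

theorem LocallyComputable.exists_algorithm {t : ℕ} {x : (S : SATAInstance) → S.Assignment}
    (hx : LocallyComputable t fun S i => S.values (fun p => x S p.1 p.2) i) :
    ∃ A : LocalAlgorithm, ∀ S, A.result S t = x S := by
  obtain ⟨φ, hφ⟩ := hx
  refine ⟨viewAlgorithm φ, fun S => ?_⟩
  funext i m
  rw [LocalAlgorithm.result, viewAlgorithm_run]
  have h : S.values (fun p => x S p.1 p.2) i m = φ (S.view t i) m := congrFun (hφ S i) m
  rw [SATAInstance.values_coe] at h
  simp [viewAlgorithm, h]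

theorem theorem1 :
    ∃ C : ℝ, ∀ ΔR ΔT h : ℕ, 2 ≤ ΔR → 2 ≤ ΔT → 1 ≤ h → ∀ ε : ℝ, 0 < ε →
      ∃ (A : LocalAlgorithm) (t : ℕ),
        (t : ℝ) ≤ C * (h * max 0 (Real.log (1 / ε))) ∧
        ∀ S : SATAInstance, S.maxPrimitivesPerRobot ≤ ΔR → S.maxPrimitivesPerTarget ≤ ΔT →
          S.IsApproxSolution ((ΔR : ℝ) * (1 + ε) * (1 + 1 / (h : ℝ)) * (1 - 1 / (ΔT : ℝ)))
            (A.result S t) := by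
  refine ⟨6, fun ΔR ΔT h hΔR hΔT hh ε hε => ?_⟩
  have hh' : (1 : ℝ) ≤ h := by exact_mod_cast hh
  have hT' : (2 : ℝ) ≤ ΔT := by exact_mod_cast hΔT
  have hT1 : 1 / 2 ≤ 1 - 1 / (ΔT : ℝ) := by
    have := div_le_div_of_nonneg_left (zero_le_one (α := ℝ)) zero_lt_two hT'
    linarith
  have averaging : ∀ h' : ℕ, 1 ≤ h' → 1 + 1 / (h' : ℝ) ≤ (1 + ε) * (1 + 1 / (h : ℝ)) →
      ((3 * h' : ℕ) : ℝ) ≤ 6 * (h * max 0 (Real.log (1 / ε))) →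
      ∃ (A : LocalAlgorithm) (t : ℕ),
        (t : ℝ) ≤ 6 * (h * max 0 (Real.log (1 / ε))) ∧
        ∀ S : SATAInstance, S.maxPrimitivesPerRobot ≤ ΔR → S.maxPrimitivesPerTarget ≤ ΔT →
          S.IsApproxSolution ((ΔR : ℝ) * (1 + ε) * (1 + 1 / (h : ℝ)) * (1 - 1 / (ΔT : ℝ)))
            (A.result S t) := by
    intro h' hh1 hratio ht
    obtain ⟨A, hA⟩ := (LocallyComputable.averaged h').exists_algorithm
    refine ⟨A, 3 * h', ht, fun S hR hT => ?_⟩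
    rw [hA S]
    refine SATAInstance.isApproxSolution_averaged hh1 hΔR hΔT hR hT ?_
    rw [mul_assoc (ΔR : ℝ) (1 + ε)]
    exact mul_le_mul_of_nonneg_right (mul_le_mul_of_nonneg_left hratio (Nat.cast_nonneg _))
      (by linarith)
  -- If `ΔR ≤ ρ`, the uniform assignment is good enough.
  by_cases htriv : 1 ≤ (1 + ε) * (1 + 1 / (h : ℝ)) * (1 - 1 / (ΔT : ℝ))
  · obtain ⟨A, hA⟩ := (LocallyComputable.values (t := 0)
      (u := fun S p => 1 / ((S.data p.1).numPrimitives : ℝ)) (LocallyComputable.const ())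
      (fun D _ _ => 1 / (D.numPrimitives : ℝ)) fun _ _ _ => rfl).exists_algorithm
      (x := fun S i _ => 1 / ((S.data i).numPrimitives : ℝ))
    refine ⟨A, 0, ?_, fun S hR _ => ?_⟩
    · rw [Nat.cast_zero]
      positivity
    · rw [hA S]
      refine SATAInstance.isApproxSolution_uniform hR ?_
      have := mul_le_mul_of_nonneg_left htriv (Nat.cast_nonneg (α := ℝ) ΔR)
      linarith
  · rcases lt_or_ge ε (1 / 2) with hε2 | hε2
    · refine averaging h hh (le_mul_of_one_le_left (by positivity) (by linarith)) ?_
      have h1 : 1 / 2 ≤ Real.log (1 / ε) := by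
        have h2 : Real.log 2 ≤ Real.log (1 / ε) :=
          Real.log_le_log two_pos ((le_div_iff₀ hε).2 (by linarith))
        linarith [Real.log_two_gt_d9]
      have h2 := mul_le_mul_of_nonneg_left (h1.trans (le_max_right 0 _)) (by linarith : (0:ℝ) ≤ h)
      push_cast
      linarith
    -- Here `1 + 1 / 2 ≤ 1 + ε`, so two levels suffice, and `h * (1 - ε) ≥ 1` leaves time for them.
    · have h0 : 0 ≤ 1 / (h : ℝ) := by positivity
      refine averaging 2 one_le_two ?_ ?_
      · have := le_mul_of_one_le_right (by linarith : 0 ≤ 1 + ε)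
          (by linarith : 1 ≤ 1 + 1 / (h : ℝ))
        push_cast
        linarith
      · have h1 : (1 + ε) * (1 + 1 / (h : ℝ)) < 2 := by
          by_contra hcon
          have h3 := mul_le_mul (not_lt.1 hcon) hT1 (by norm_num)
            (zero_le_two.trans (not_lt.1 hcon))
          exact htriv (by linarith)
        have h2 : (1 + ε) * (h + 1) < 2 * h := by
          have h3 := mul_lt_mul_of_pos_right h1 (by linarith : (0 : ℝ) < h)
          have h4 : (1 + ε) * (1 + 1 / (h : ℝ)) * h = (1 + ε) * (h + 1) := by field_simp
          linarith
        have h5 : 1 - ε ≤ Real.log (1 / ε) := by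
          have := Real.one_sub_inv_le_log_of_pos (one_div_pos.2 hε)
          simpa using this
        have h6 := mul_le_mul_of_nonneg_left (h5.trans (le_max_right 0 _))
          (by linarith : (0 : ℝ) ≤ h)
        push_cast
        linarith
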